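/- All graphs are finite and simple, and a subgraph $H$ of $G$ (induced or not) is called proper if $H\neq G$. For $n\ge 4$, the wheel $W_n$ is the graph on $n$ vertices $c,w_1,\dots,w_{n-1}$ whose edges are $cw_i$ and $w_iw_{i+1}$ for $1\le i\le n-1$ (indices modulo $n-1$). For $n\ge 4$, let $H_n$ be the graph on $n$ vertices $x,y,v_1,\dots,v_{n-2}$ with edges $v_iv_{i+1}$ for $1\le i\le n-3$, $xv_i$ for $1\le i\le n-2$, $yv_1$ and $yv_{n-2}$; the vertices $x$ and $y$ are called the connectors of $H_n$. Let $G$ be a graph with $n\ge 2$ vertices. Then $G$ has exactly $2n-2$ edges and no proper (not necessarily induced) subgraph of minimum degree $3$ if and only if $G$ is isomorphic to the wheel $W_n$ (with $n\ge 4$), or $G$ is isomorphic to a graph formed, for some $i,j\ge 4$, from disjoint copies of $H_i$, with connectors $x,y$, and of $H_j$, with connectors $x',y'$, by identifying either $x$ with $x'$ and $y$ with $y'$, or $x$ with $y'$ and $y$ with $x'$. -/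

import Mathlib

/-- The wheel with `m` outside vertices `some 0, …, some (m - 1)`, in this cyclic order, and
centre `none`; it has `m + 1` vertices. -/
def wheelGraph (m : ℕ) : SimpleGraph (Option (Fin m)) where
  Adj
    | none, none => False
    | none, some _ => True
    | some _, none => True
    | some i, some j => (SimpleGraph.cycleGraph m).Adj i j
  symm := ⟨by
    rintro (_ | i) (_ | j) h
    · exact h
    · trivial
    · trivial
    · exact SimpleGraph.Adj.symm h⟩
  loopless := ⟨by
    rintro (_ | i) h
    · exact h
    · exact SimpleGraph.irrefl _ h⟩

/-- `G` is a wheel: a copy of a wheel with at least three outside vertices. -/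
def IsWheel {V : Type*} (G : SimpleGraph V) : Prop :=
  ∃ m : ℕ, 3 ≤ m ∧ Nonempty (G ≃g wheelGraph m)

/-- The `n` vertices (for `2 ≤ n`) of the graph `H_n`: the connectors `x` and `y`, and the internal
vertices `v 0, …, v (n - 3)`. -/
inductive HVertex (n : ℕ) : Type
  | x : HVertex n
  | y : HVertex n
  | v (i : Fin (n - 2)) : HVertex n

/-- The edges of `H_n`, each listed in one direction. -/
inductive HEdge (n : ℕ) : HVertex n → HVertex n → Prop
  | path (i j : Fin (n - 2)) (h : (i : ℕ) + 1 = j) : HEdge n (.v i) (.v j)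
  | x (i : Fin (n - 2)) : HEdge n .x (.v i)
  | y_first (i : Fin (n - 2)) (h : (i : ℕ) = 0) : HEdge n .y (.v i)
  | y_last (i : Fin (n - 2)) (h : (i : ℕ) + 1 = n - 2) : HEdge n .y (.v i)

/-- The graph `H_n` (used for `4 ≤ n`): a path on the internal vertices, with `x` joined to all of
them and `y` joined to the first and the last of them. -/
def HGraph (n : ℕ) : SimpleGraph (HVertex n) := SimpleGraph.fromRel (HEdge n)

/-- `G` is formed from a copy of `H_i` and a copy of `H_j`, for some `i, j ≥ 4`, that share exactly
their connectors, identified as `x = x'`, `y = y'` or as `x = y'`, `y = x'`. -/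
def IsHGluing {V : Type*} (G : SimpleGraph V) : Prop :=
  ∃ i j : ℕ, 4 ≤ i ∧ 4 ≤ j ∧ ∃ (f : HVertex i ↪ V) (g : HVertex j ↪ V),
    ((f .x = g .x ∧ f .y = g .y) ∨ (f .x = g .y ∧ f .y = g .x)) ∧
    Set.range f ∩ Set.range g = {f .x, f .y} ∧
    Set.range f ∪ Set.range g = Set.univ ∧
    G = (HGraph i).map f ⊔ (HGraph j).map g

open Classical in
/-- The finite graph `G` has `2 |G| - 2` edges and no proper (not necessarily induced) subgraph of
minimum degree `3`. -/
def NonInducedCritical {V : Type*} [Fintype V] (G : SimpleGraph V) : Prop :=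
  G.edgeSet.ncard + 2 = 2 * Fintype.card V ∧
    ∀ H : G.Subgraph, H ≠ ⊤ → H.coe.minDegree ≠ 3

/-!
A subgraph is handled through the sum of the degrees inside a vertex set. If every subset of the
complement of `W` has a vertex with at most two neighbours in it, then that complement spans few
edges; comparing with the `2n - 2` edges of a critical graph `G` bounds the edges inside `W` from
above. A critical graph has minimum degree `3`, and each of its edges has an end of degree `3`,
since otherwise the edge could be deleted. So the components of the subgraph on the cubic vertices
carry the structure. A component missing at most one vertex gives a wheel. If every component
misses two vertices, each component is a tree, and edge counting shows that there are exactly two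
components and two non-cubic vertices `s`, `t`. The complement of one component is degenerate,
so `s` or `t`, say `t`, has at most two neighbours in the other component `Q`; counting degrees
makes `Q ∪ {t}` a cycle, and `s` is then joined to exactly `Q`.

Conversely, a subgraph of minimum degree `3` that contains a cubic vertex contains all of its
edges, so it spreads along the rim of a wheel or along the path of an `H_n`; in a gluing it passes
through the connector of degree `2` into the other piece.
-/

open Finset

section Cycles

variable {V W : Type*}

theorem nonempty_iso_of_bijective_hom {G : SimpleGraph V} {H : SimpleGraph W} [G.LocallyFinite]
    [H.LocallyFinite] (f : G →g H) (hf : Function.Bijective f)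
    (hdeg : ∀ v, H.degree (f v) ≤ G.degree v) : Nonempty (G ≃g H) := by
  classical
  have himage (v : V) : (G.neighborFinset v).image f = H.neighborFinset (f v) := by
    refine eq_of_subset_of_card_le (fun w hw => ?_) ?_
    · obtain ⟨u, hu, rfl⟩ := mem_image.1 hw
      exact (H.mem_neighborFinset _ _).2 (f.map_adj ((G.mem_neighborFinset _ _).1 hu))
    · rw [card_image_of_injective _ hf.injective]
      exact hdeg v
  refine ⟨⟨Equiv.ofBijective f hf, fun {v w} => ⟨fun h => ?_, f.map_adj⟩⟩⟩
  obtain ⟨u, hu, huw⟩ := mem_image.1 ((himage v).ge ((H.mem_neighborFinset _ _).2 h))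
  rwa [← hf.injective huw, ← G.mem_neighborFinset]

theorem exists_iso_cycleGraph_apply_eq_zero {m : ℕ} {G : SimpleGraph V}
    (e : G ≃g SimpleGraph.cycleGraph (m + 1)) (v : V) :
    ∃ e' : G ≃g SimpleGraph.cycleGraph (m + 1), e' v = 0 := by
  refine ⟨e.trans ⟨Equiv.subRight (e v), fun {a b} => ?_⟩, by simp⟩
  simp only [SimpleGraph.cycleGraph_adj', Equiv.subRight_apply, sub_sub_sub_cancel_right]

theorem exists_isHamiltonianCycle_of_degree_eq_two [Finite V] [DecidableEq V] {G : SimpleGraph V}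
    [G.LocallyFinite] (hconn : G.Connected) (hdeg : ∀ v, G.degree v = 2) (v : V) :
    ∃ p : G.Walk v v, p.IsHamiltonianCycle := by
  have hncard (u : V) : (G.neighborSet u).ncard = 2 := by
    rw [← hdeg u, ← G.card_neighborFinset_eq_degree, ← G.coe_neighborFinset,
      Set.ncard_coe_finset]
  obtain ⟨p, hp, hverts⟩ :=
    SimpleGraph.IsCycles.exists_cycle_toSubgraph_verts_eq_connectedComponentSupp
      (c := G.connectedComponentMk v) (fun u _ => hncard u) rfl
      (Set.nonempty_of_ncard_ne_zero (by rw [hncard]; decide))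
  refine ⟨p, hp, hp.isPath_tail.isHamiltonian_of_mem fun u => ?_⟩
  have hu : u ∈ p.support := by
    rw [← p.mem_verts_toSubgraph, hverts]
    exact SimpleGraph.ConnectedComponent.sound (hconn u v)
  rw [p.support_tail_of_not_nil hp.not_nil]
  rcases p.mem_support_iff.1 hu with rfl | hu
  · exact p.end_mem_tail_support hp.not_nil
  · exact hu

theorem exists_iso_cycleGraph_of_degree_eq_two [Finite V] {G : SimpleGraph V} [G.LocallyFinite]
    (hconn : G.Connected) (hdeg : ∀ v, G.degree v = 2) (v : V) :
    ∃ m, 2 ≤ m ∧ ∃ e : G ≃g SimpleGraph.cycleGraph (m + 1), e v = 0 := by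
  classical
  have := Fintype.ofFinite V
  obtain ⟨p, hp⟩ := exists_isHamiltonianCycle_of_degree_eq_two hconn hdeg v
  have hlen := hp.isCycle.three_le_length
  obtain ⟨m, hm⟩ : ∃ m, p.length = m + 3 := ⟨p.length - 3, by omega⟩
  obtain ⟨f⟩ := (SimpleGraph.cycleGraph_isContained_iff (by omega)).2 ⟨v, p, hp.isCycle, hm⟩
  have hf : Function.Bijective f.toHom :=
    (Fintype.bijective_iff_injective_and_card _).2 ⟨f.injective, by simp [← hp.length_eq, hm]⟩
  obtain ⟨e⟩ := nonempty_iso_of_bijective_hom f.toHom hf fun i => by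
    rw [hdeg, SimpleGraph.cycleGraph_degree_three_le]
  exact ⟨m + 2, by omega, exists_iso_cycleGraph_apply_eq_zero e.symm v⟩

end Cycles

section Counting

variable {V : Type*} (G : SimpleGraph V) [DecidableRel G.Adj]

/-- The number of neighbours of `v` in `U`. -/
def degreeIn (U : Finset V) (v : V) : ℕ := #{w ∈ U | G.Adj v w}

variable {G}

theorem degreeIn_mono {A B : Finset V} (h : A ⊆ B) (v : V) : degreeIn G A v ≤ degreeIn G B v :=
  card_le_card (filter_subset_filter _ h)

theorem degreeIn_pos {U : Finset V} {v : V} : 0 < degreeIn G U v ↔ ∃ w ∈ U, G.Adj v w := by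
  simp [degreeIn, card_pos, Finset.Nonempty]

theorem degreeIn_univ [Fintype V] (v : V) : degreeIn G univ v = G.degree v := by
  rw [degreeIn, ← G.card_neighborFinset_eq_degree, G.neighborFinset_eq_filter]

theorem degreeIn_eq_degree [Fintype V] {U : Finset V} {v : V} (h : ∀ w, G.Adj v w → w ∈ U) :
    degreeIn G U v = G.degree v := by
  rw [← degreeIn_univ, degreeIn, degreeIn]
  congr 1
  ext w
  simpa using h w

theorem card_interedges_eq_sum (A B : Finset V) :
    #(G.interedges A B) = ∑ v ∈ A, degreeIn G B v := by
  simp only [SimpleGraph.interedges, Rel.interedges, degreeIn, card_filter, sum_product]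

theorem card_interedges_singleton (v : V) (U : Finset V) :
    #(G.interedges {v} U) = degreeIn G U v := by
  rw [card_interedges_eq_sum, sum_singleton]

theorem card_interedges_comm (A B : Finset V) : #(G.interedges A B) = #(G.interedges B A) :=
  haveI := G.symm
  Rel.card_interedges_comm A B

theorem card_interedges_univ [Fintype V] :
    #(G.interedges univ univ) = 2 * G.edgeSet.ncard := by
  rw [← G.coe_edgeFinset, Set.ncard_coe_finset, ← G.sum_degrees_eq_twice_card_edges]
  simp only [card_interedges_eq_sum, degreeIn_univ]

theorem card_interedges_self_add_card_le (U : Finset V) : #(G.interedges U U) + #U ≤ #U * #U := by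
  have hsub : G.interedges U U ⊆ U.offDiag := fun p hp => by
    obtain ⟨h₁, h₂, h⟩ := Rel.mem_interedges_iff.1 hp
    exact mem_offDiag.2 ⟨h₁, h₂, h.ne⟩
  have hcard := card_le_card hsub
  rw [offDiag_card] at hcard
  have := Nat.le_mul_self #U
  omega

variable [DecidableEq V]

theorem degreeIn_union {A B : Finset V} (h : Disjoint A B) (v : V) :
    degreeIn G (A ∪ B) v = degreeIn G A v + degreeIn G B v := by
  rw [degreeIn, filter_union, card_union_of_disjoint (disjoint_filter_filter h)]
  rfl

theorem degreeIn_add_degreeIn_compl [Fintype V] (U : Finset V) (v : V) :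
    degreeIn G U v + degreeIn G Uᶜ v = G.degree v := by
  rw [← degreeIn_union disjoint_compl_right, union_compl, degreeIn_univ]

theorem card_interedges_union_self {A B : Finset V} (h : Disjoint A B) :
    #(G.interedges (A ∪ B) (A ∪ B)) =
      #(G.interedges A A) + 2 * #(G.interedges A B) + #(G.interedges B B) := by
  have hcomm := card_interedges_comm (G := G) A B
  simp only [card_interedges_eq_sum, sum_union h, degreeIn_union h, sum_add_distrib] at hcomm ⊢
  omega

theorem degreeIn_insert {U : Finset V} {u : V} (hu : u ∉ U) (v : V) :
    degreeIn G (insert u U) v = degreeIn G U v + if G.Adj v u then 1 else 0 := by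
  simp only [degreeIn, card_filter, sum_insert hu, add_comm]

theorem card_interedges_self_insert {U : Finset V} {v : V} (hv : v ∉ U) :
    #(G.interedges (insert v U) (insert v U)) = #(G.interedges U U) + 2 * degreeIn G U v := by
  have hself : degreeIn G {v} v = 0 := by simp [degreeIn]
  rw [← singleton_union, card_interedges_union_self (disjoint_singleton_left.2 hv),
    card_interedges_singleton, card_interedges_singleton, hself]
  ring

theorem card_interedges_compl_add [Fintype V] (U : Finset V) :
    #(G.interedges Uᶜ Uᶜ) + 2 * ∑ v ∈ U, G.degree v =
      2 * G.edgeSet.ncard + #(G.interedges U U) := by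
  have hsum : ∑ v ∈ U, G.degree v = #(G.interedges U U) + #(G.interedges U Uᶜ) := by
    simp only [card_interedges_eq_sum, ← sum_add_distrib, degreeIn_add_degreeIn_compl]
  rw [← card_interedges_univ, ← union_compl U, card_interedges_union_self disjoint_compl_right,
    hsum]
  ring

end Counting

section Degeneracy

variable {V : Type*} {G : SimpleGraph V} [DecidableRel G.Adj]

theorem card_interedges_self_le_of_degenerate {d : ℕ} {U : Finset V} (hd : d ≤ #U)
    (h : ∀ W ⊆ U, W.Nonempty → ∃ v ∈ W, degreeIn G W v ≤ d) :
    #(G.interedges U U) + d * (d + 1) ≤ 2 * d * #U := by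
  classical
  induction U using Finset.strongInduction with
  | H U ih =>
    obtain hcard | hcard := hd.eq_or_lt
    · have := card_interedges_self_add_card_le (G := G) U
      rw [← hcard] at this ⊢
      linarith
    · obtain ⟨v, hv, hdeg⟩ := h U Subset.rfl (card_pos.1 (by omega))
      have herase := card_erase_of_mem hv
      have hle := ih (U.erase v) (erase_ssubset hv) (by omega)
        fun W hW => h W (hW.trans (erase_subset v U))
      have hmono := degreeIn_mono (G := G) (erase_subset v U) v
      have hinsert := card_interedges_self_insert (G := G) (notMem_erase v U)
      rw [insert_erase hv] at hinsert
      obtain ⟨k, hk⟩ : ∃ k, #U = k + 1 := ⟨#U - 1, by omega⟩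
      rw [herase, hk, Nat.add_sub_cancel] at hle
      rw [hinsert, hk]
      linarith

end Degeneracy

section Subgraphs

variable {V : Type*} {G : SimpleGraph V}

/-- The subgraph `H` has a vertex, and each of its vertices has at least `d` neighbours in `H`.
For `0 < d` this says `d ≤ H.coe.minDegree`, without decidability instances. -/
def MinDegreeAtLeast (H : G.Subgraph) (d : ℕ) : Prop :=
  H.verts.Nonempty ∧ ∀ v ∈ H.verts, d ≤ (H.neighborSet v).ncard

theorem ncard_neighborSet_eq_coe_degree (H : G.Subgraph) (v : H.verts)
    [Fintype (H.coe.neighborSet v)] : (H.neighborSet v).ncard = H.coe.degree v := by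
  have := Fintype.ofEquiv _ (H.coeNeighborSetEquiv v)
  rw [H.coe_degree, SimpleGraph.Subgraph.degree, ← Nat.card_eq_fintype_card]
  rfl

theorem ncard_neighborSet_le_deleteEdges_add_one [Finite V] (H : G.Subgraph) (v w z : V) :
    (H.neighborSet z).ncard ≤ ((H.deleteEdges {s(v, w)}).neighborSet z).ncard + 1 := by
  obtain ⟨x, hx⟩ : ∃ x, H.neighborSet z ⊆ insert x ((H.deleteEdges {s(v, w)}).neighborSet z) := by
    rcases eq_or_ne z v with rfl | hz
    · refine ⟨w, fun y hy => ?_⟩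
      simp_all [or_iff_not_imp_left]
    · refine ⟨v, fun y hy => ?_⟩
      simp_all [or_iff_not_imp_left]
  exact (Set.ncard_le_ncard hx).trans (Set.ncard_insert_le _ _)

theorem neighborSet_deleteEdges_of_ne (H : G.Subgraph) {v w z : V} (hv : z ≠ v) (hw : z ≠ w) :
    (H.deleteEdges {s(v, w)}).neighborSet z = H.neighborSet z := by
  ext y
  simp [hv, hw]

theorem eq_top_of_forall_adj {H : G.Subgraph} (hG : ∀ v, ∃ w, G.Adj v w)
    (hadj : ∀ v w, G.Adj v w → H.Adj v w) : H = ⊤ := by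
  refine top_unique ⟨fun v _ => ?_, hadj⟩
  obtain ⟨w, hw⟩ := hG v
  exact (hadj v w hw).fst_mem

namespace MinDegreeAtLeast

variable {H : G.Subgraph} {d : ℕ}

theorem le_minDegree [Fintype H.verts] [DecidableRel H.coe.Adj] (hH : MinDegreeAtLeast H d) :
    d ≤ H.coe.minDegree := by
  have := hH.1.to_subtype
  refine H.coe.le_minDegree_of_forall_le_degree d fun v => ?_
  rw [← ncard_neighborSet_eq_coe_degree]
  exact hH.2 v v.2

theorem of_le_minDegree [Fintype H.verts] [DecidableRel H.coe.Adj] (hd : 0 < d)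
    (h : d ≤ H.coe.minDegree) : MinDegreeAtLeast H d := by
  constructor
  · by_contra hne
    have := Set.isEmpty_coe_sort.2 (Set.not_nonempty_iff_eq_empty.1 hne)
    rw [SimpleGraph.minDegree_of_subsingleton] at h
    omega
  · intro v hv
    rw [ncard_neighborSet_eq_coe_degree H ⟨v, hv⟩]
    exact h.trans (H.coe.minDegree_le_degree _)

/-- Deleting an edge lowers every degree by at most one, so in a minimal subgraph of minimum
degree at least `d` the bound is attained. -/
theorem exists_le_minDegree_eq [Finite V] (hH : MinDegreeAtLeast H d) :
    ∃ K ≤ H, ∀ (_ : Fintype K.verts) (_ : DecidableRel K.coe.Adj), K.coe.minDegree = d := by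
  obtain ⟨K, ⟨hKH, hK⟩, hmin⟩ :=
    (Set.toFinite {K | K ≤ H ∧ MinDegreeAtLeast K d}).exists_minimal ⟨H, le_rfl, hH⟩
  refine ⟨K, hKH, fun _ _ => hK.le_minDegree.antisymm' ?_⟩
  by_contra! hlt
  have hdeg := (of_le_minDegree d.succ_pos hlt).2
  obtain ⟨v, hv⟩ := hK.1
  obtain ⟨w, hw⟩ : (K.neighborSet v).Nonempty :=
    Set.nonempty_of_ncard_ne_zero (by have := hdeg v hv; omega)
  have hle : K.deleteEdges {s(v, w)} ≤ K := K.deleteEdges_le _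
  have hdel : MinDegreeAtLeast (K.deleteEdges {s(v, w)}) d := by
    refine ⟨⟨v, hv⟩, fun z hz => ?_⟩
    have := hdeg z hz
    have := ncard_neighborSet_le_deleteEdges_add_one K v w z
    omega
  simpa using (hmin ⟨hle.trans hKH, hdel⟩ hle).2 hw

theorem exists_adj_notMem (hH : MinDegreeAtLeast H d) {v : V} (hv : v ∈ H.verts) {A : Finset V}
    (hA : #A < d) : ∃ w, H.Adj v w ∧ w ∉ A := by
  by_contra! hsub
  have hle := Set.ncard_le_ncard (s := H.neighborSet v) (t := A) hsub A.finite_toSet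
  rw [Set.ncard_coe_finset] at hle
  have := hH.2 v hv
  omega

theorem adj_of_degree_le [G.LocallyFinite] (hH : MinDegreeAtLeast H d) {v w : V}
    (hv : v ∈ H.verts) (hdeg : G.degree v ≤ d) (hw : G.Adj v w) : H.Adj v w := by
  have hsub : H.neighborSet v ⊆ G.neighborFinset v := by
    simpa using H.neighborSet_subset v
  have heq := Set.eq_of_subset_of_ncard_le hsub
    (by rw [Set.ncard_coe_finset]; exact hdeg.trans (hH.2 v hv)) (finite_toSet _)
  exact heq.ge (by simpa using hw)

theorem adj_of_hom [G.LocallyFinite] (hH : MinDegreeAtLeast H d) {W : Type*} {P : SimpleGraph W}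
    (hP : P.Preconnected) (φ : P →g G) (hdeg : ∀ w, G.degree (φ w) ≤ d) {w₀ : W}
    (hw₀ : φ w₀ ∈ H.verts) (w : W) {v : V} (hv : G.Adj (φ w) v) : H.Adj (φ w) v := by
  have hmem : φ w ∈ H.verts := by
    obtain ⟨p⟩ := hP w₀ w
    induction p with
    | nil => exact hw₀
    | cons h _ ih => exact ih (hH.adj_of_degree_le hw₀ (hdeg _) (φ.map_adj h)).snd_mem hv
  exact hH.adj_of_degree_le hmem (hdeg w) hv

end MinDegreeAtLeast

theorem nonInducedCritical_iff [Fintype V] :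
    NonInducedCritical G ↔ G.edgeSet.ncard + 2 = 2 * Fintype.card V ∧
      ∀ H : G.Subgraph, MinDegreeAtLeast H 3 → H = ⊤ := by
  classical
  refine and_congr_right fun _ => ⟨fun h H hH => ?_, fun h H hne hdeg => ?_⟩
  · obtain ⟨K, hKH, hK⟩ := hH.exists_le_minDegree_eq
    by_contra hne
    exact h K (fun hKtop => hne (top_le_iff.1 (hKtop ▸ hKH))) (hK _ _)
  · exact hne (h H (.of_le_minDegree three_pos hdeg.ge))

end Subgraphs

namespace NonInducedCritical

variable {V : Type*} [Fintype V] {G : SimpleGraph V}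

theorem exists_ncard_neighborSet_le_two (hG : NonInducedCritical G) {H : G.Subgraph}
    (hne : H.verts.Nonempty) (hH : H ≠ ⊤) : ∃ v ∈ H.verts, (H.neighborSet v).ncard ≤ 2 := by
  by_contra! h
  exact hH ((nonInducedCritical_iff.1 hG).2 H ⟨hne, h⟩)

theorem four_le_card [Nontrivial V] (hG : NonInducedCritical G) : 4 ≤ Fintype.card V := by
  classical
  have hedges := hG.1
  have hle := card_interedges_self_add_card_le (G := G) univ
  rw [card_interedges_univ, card_univ] at hle
  have hV := Fintype.one_lt_card (α := V)
  by_contra! h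
  interval_cases Fintype.card V <;> omega

variable [DecidableRel G.Adj]

theorem exists_degreeIn_le_two (hG : NonInducedCritical G) {U : Finset V} (hne : U.Nonempty)
    (hU : U ≠ univ) : ∃ v ∈ U, degreeIn G U v ≤ 2 := by
  obtain ⟨v, hv, hdeg⟩ := hG.exists_ncard_neighborSet_le_two
    (H := (⊤ : G.Subgraph).induce U) (by simpa using hne)
    fun h => hU (by simpa using congrArg SimpleGraph.Subgraph.verts h)
  have hv : v ∈ U := by simpa using hv
  refine ⟨v, hv, hdeg.trans_eq' ?_⟩
  rw [degreeIn, ← Set.ncard_coe_finset]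
  congr 1
  ext w
  simp [hv]

/-- Compare the number of edges of `G` with the degeneracy bound on the complement of `W`. -/
theorem card_interedges_self_add_le [DecidableEq V] (hG : NonInducedCritical G) {W : Finset V}
    (hW : W.Nonempty) (hWc : 2 ≤ #Wᶜ) :
    #(G.interedges W W) + 4 * #W + 2 ≤ 2 * ∑ v ∈ W, G.degree v := by
  have hbound := card_interedges_self_le_of_degenerate (G := G) hWc fun U hU hne =>
    hG.exists_degreeIn_le_two hne fun h => by
      obtain ⟨w, hw⟩ := hW
      exact mem_compl.1 (hU (h ▸ mem_univ w)) hw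
  have hcompl := card_interedges_compl_add (G := G) W
  have hcard := card_add_card_compl W
  have hedges := hG.1
  omega

theorem three_le_degree [Nontrivial V] (hG : NonInducedCritical G) (v : V) :
    3 ≤ G.degree v := by
  classical
  have hcard := hG.four_le_card
  have hle := hG.card_interedges_self_add_le (singleton_nonempty v)
    (by rw [card_compl, card_singleton]; omega)
  rw [card_singleton, sum_singleton] at hle
  omega

/-- Otherwise deleting the edge would leave a proper subgraph of minimum degree at least `3`. -/
theorem degree_eq_three_of_adj (hG : NonInducedCritical G) {v w : V} (h : G.Adj v w) :
    G.degree v = 3 ∨ G.degree w = 3 := by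
  have := h.nontrivial
  by_contra! hne
  obtain ⟨u, -, hu⟩ := hG.exists_ncard_neighborSet_le_two
    (H := (⊤ : G.Subgraph).deleteEdges {s(v, w)}) ⟨v, trivial⟩ fun htop => by
      simpa using htop.ge.2 (show (⊤ : G.Subgraph).Adj v w from h)
  have htop (z : V) : ((⊤ : G.Subgraph).neighborSet z).ncard = G.degree z := by
    rw [← G.card_neighborFinset_eq_degree, ← Set.ncard_coe_finset]
    simp
  have hle := ncard_neighborSet_le_deleteEdges_add_one (⊤ : G.Subgraph) v w u
  have hthree := hG.three_le_degree u
  by_cases hend : u = v ∨ u = w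
  · rw [htop] at hle
    grind
  · rw [not_or] at hend
    rw [neighborSet_deleteEdges_of_ne _ hend.1 hend.2, htop] at hu
    omega

end NonInducedCritical

section InducedSubgraphs

variable {V : Type*} {G : SimpleGraph V} [DecidableRel G.Adj]

theorem degree_induce_eq_degreeIn (U : Finset V) (v : (U : Set V)) :
    (G.induce (U : Set V)).degree v = degreeIn G U v := by
  rw [← SimpleGraph.card_neighborFinset_eq_degree, degreeIn,
    ← card_map (Function.Embedding.subtype (· ∈ (U : Set V)))]
  congr 1
  ext w
  simp [and_comm]

theorem two_mul_card_le_of_connected_induce {U : Finset V}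
    (hU : (G.induce (U : Set V)).Connected) : 2 * #U ≤ #(G.interedges U U) + 2 := by
  have hdeg : ∑ v, (G.induce (U : Set V)).degree v = #(G.interedges U U) := by
    simp only [degree_induce_eq_degreeIn, card_interedges_eq_sum]
    exact sum_coe_sort U (degreeIn G U)
  have hsum := (G.induce (U : Set V)).sum_degrees_eq_twice_card_edges
  have hle := hU.card_vert_le_card_edgeSet_add_one
  rw [Nat.card_eq_fintype_card, Nat.card_eq_fintype_card, ← SimpleGraph.edgeFinset_card] at hle
  simp only [coe_sort_coe, Fintype.card_coe] at hle
  omega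

end InducedSubgraphs

section Components

variable {V : Type*} {G : SimpleGraph V} {S : Finset V}

open Classical in
/-- The vertices of the connected component `c` of the subgraph induced by `S`, as vertices of
the ambient graph. -/
noncomputable def componentVerts (c : (G.induce (S : Set V)).ConnectedComponent) : Finset V :=
  (univ.filter fun v => (G.induce (S : Set V)).connectedComponentMk v = c).map
    (Function.Embedding.subtype (· ∈ (S : Set V)))

theorem mem_componentVerts {c : (G.induce (S : Set V)).ConnectedComponent} {v : V} :
    v ∈ componentVerts c ↔
      ∃ h : v ∈ S, (G.induce (S : Set V)).connectedComponentMk ⟨v, h⟩ = c := by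
  simp [componentVerts]

variable {c : (G.induce (S : Set V)).ConnectedComponent}

theorem componentVerts_subset : componentVerts c ⊆ S := fun _ hv =>
  (mem_componentVerts.1 hv).1

theorem componentVerts_nonempty : (componentVerts c).Nonempty := by
  obtain ⟨v, rfl⟩ := c.exists_rep
  exact ⟨v, mem_componentVerts.2 ⟨v.2, rfl⟩⟩

theorem mem_componentVerts_of_adj {v w : V} (hv : v ∈ componentVerts c) (hw : w ∈ S)
    (h : G.Adj v w) : w ∈ componentVerts c := by
  obtain ⟨hvS, rfl⟩ := mem_componentVerts.1 hv
  exact mem_componentVerts.2 ⟨hw, SimpleGraph.ConnectedComponent.sound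
    (SimpleGraph.Adj.reachable (G := G.induce (S : Set V)) (u := ⟨w, hw⟩) (v := ⟨v, hvS⟩) h.symm)⟩

theorem mem_compl_union_componentVerts_of_adj [Fintype V] [DecidableEq V] {v w : V}
    (hv : v ∈ componentVerts c) (h : G.Adj v w) : w ∈ Sᶜ ∪ componentVerts c := by
  by_cases hw : w ∈ S
  · exact mem_union_right _ (mem_componentVerts_of_adj hv hw h)
  · exact mem_union_left _ (mem_compl.2 hw)

theorem exists_mem_componentVerts {v : V} (hv : v ∈ S) :
    ∃ c : (G.induce (S : Set V)).ConnectedComponent, v ∈ componentVerts c :=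
  ⟨_, mem_componentVerts.2 ⟨hv, rfl⟩⟩

theorem disjoint_componentVerts {d : (G.induce (S : Set V)).ConnectedComponent} (h : c ≠ d) :
    Disjoint (componentVerts c) (componentVerts d) :=
  disjoint_left.2 fun _ hc hd => by
    obtain ⟨_, rfl⟩ := mem_componentVerts.1 hc
    exact h (mem_componentVerts.1 hd).2

theorem connected_induce_componentVerts :
    (G.induce (componentVerts c : Set V)).Connected := by
  let φ : c.toSimpleGraph →g G.induce (componentVerts c : Set V) :=
    ⟨fun v => ⟨v, mem_componentVerts.2 ⟨v.1.2, v.2⟩⟩, fun h => h⟩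
  refine c.connected_toSimpleGraph.map φ ?_
  rintro ⟨v, hv⟩
  obtain ⟨hS, hc⟩ := mem_componentVerts.1 hv
  exact ⟨⟨⟨v, hS⟩, hc⟩, rfl⟩

theorem sum_componentVerts [Fintype (G.induce (S : Set V)).ConnectedComponent] (f : V → ℕ) :
    ∑ c : (G.induce (S : Set V)).ConnectedComponent, ∑ v ∈ componentVerts c, f v =
      ∑ v ∈ S, f v := by
  classical
  simp only [componentVerts, sum_map, Function.Embedding.subtype_apply]
  refine Eq.trans ?_ (sum_coe_sort S f)
  convert sum_fiberwise univ (G.induce (S : Set V)).connectedComponentMk fun v => f v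

theorem sum_card_componentVerts [Fintype (G.induce (S : Set V)).ConnectedComponent] :
    ∑ c : (G.induce (S : Set V)).ConnectedComponent, #(componentVerts c) = #S := by
  simpa only [card_eq_sum_ones] using sum_componentVerts fun _ => 1

theorem degreeIn_componentVerts [DecidableRel G.Adj] {v : V} (hv : v ∈ componentVerts c) :
    degreeIn G (componentVerts c) v = degreeIn G S v := by
  rw [degreeIn, degreeIn]
  congr 1
  ext w
  simp only [mem_filter]
  exact ⟨fun ⟨hw, h⟩ => ⟨componentVerts_subset hw, h⟩,
    fun ⟨hw, h⟩ => ⟨mem_componentVerts_of_adj hv hw h, h⟩⟩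

end Components

section Cubic

variable {V : Type*} [Fintype V] {G : SimpleGraph V} [DecidableRel G.Adj]

variable (G) in
/-- The set of vertices of degree `3`. -/
def cubic : Finset V := {v | G.degree v = 3}

theorem mem_cubic {v : V} : v ∈ cubic G ↔ G.degree v = 3 := by
  simp [cubic]

variable (G) in
/-- The connected components of the subgraph induced by the vertices of degree `3`. -/
abbrev CubicComponent : Type _ := (G.induce (cubic G : Set V)).ConnectedComponent

theorem degree_eq_three_of_mem_componentVerts {c : CubicComponent G} {v : V}
    (hv : v ∈ componentVerts c) : G.degree v = 3 :=
  mem_cubic.1 (componentVerts_subset hv)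

theorem sum_degree_componentVerts (c : CubicComponent G) :
    ∑ v ∈ componentVerts c, G.degree v = #(componentVerts c) * 3 :=
  sum_const_nat fun _ => degree_eq_three_of_mem_componentVerts

variable [DecidableEq V]

namespace NonInducedCritical

/-- Components of the cubic subgraph that miss two vertices are trees. -/
theorem card_interedges_componentVerts (hG : NonInducedCritical G) {c : CubicComponent G}
    (hc : 2 ≤ #(componentVerts c)ᶜ) :
    #(G.interedges (componentVerts c) (componentVerts c)) + 2 = 2 * #(componentVerts c) := by
  have hupper := hG.card_interedges_self_add_le componentVerts_nonempty hc
  have hlower := two_mul_card_le_of_connected_induce (connected_induce_componentVerts (c := c))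
  rw [sum_degree_componentVerts] at hupper
  omega

theorem card_interedges_compl_cubic (hG : NonInducedCritical G) :
    #(G.interedges (cubic G)ᶜ (cubic G)ᶜ) = 0 := by
  rw [card_interedges_eq_sum]
  refine sum_eq_zero fun v hv => Nat.eq_zero_of_not_pos fun hpos => ?_
  obtain ⟨w, hw, h⟩ := degreeIn_pos.1 hpos
  rw [mem_compl, mem_cubic] at hv hw
  exact (hG.degree_eq_three_of_adj h).elim hv hw

theorem card_cubicComponent_add_two [Fintype (CubicComponent G)] (hG : NonInducedCritical G)
    (hc : ∀ c : CubicComponent G, 2 ≤ #(componentVerts c)ᶜ) :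
    Fintype.card (CubicComponent G) + 2 = 2 * #(cubic G)ᶜ := by
  have hsum : #(G.interedges (cubic G) (cubic G)) + 2 * Fintype.card (CubicComponent G) =
      2 * #(cubic G) := by
    have htree (c : CubicComponent G) :
        ∑ v ∈ componentVerts c, degreeIn G (cubic G) v + 2 = 2 * #(componentVerts c) := by
      rw [← hG.card_interedges_componentVerts (hc c), card_interedges_eq_sum]
      exact congrArg (· + 2) (sum_congr rfl fun v hv => (degreeIn_componentVerts hv).symm)
    calc
      _ = ∑ c : CubicComponent G, (∑ v ∈ componentVerts c, degreeIn G (cubic G) v + 2) := by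
        rw [sum_add_distrib, sum_componentVerts, sum_const, card_univ, smul_eq_mul, mul_comm 2,
          card_interedges_eq_sum]
      _ = 2 * #(cubic G) := by
        rw [sum_congr rfl fun c _ => htree c, ← mul_sum, sum_card_componentVerts]
  have hcompl := card_interedges_compl_add (G := G) (cubic G)
  rw [hG.card_interedges_compl_cubic, sum_const_nat fun v hv => mem_cubic.1 hv] at hcompl
  have hcard := card_add_card_compl (cubic G)
  have hedges := hG.1
  omega

theorem exists_degreeIn_compl_componentVerts_le_two (hG : NonInducedCritical G)
    (c : CubicComponent G) (hc : (componentVerts c)ᶜ.Nonempty) :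
    ∃ v ∈ (cubic G)ᶜ, degreeIn G (componentVerts c)ᶜ v ≤ 2 := by
  obtain ⟨v, hv, hdeg⟩ := hG.exists_degreeIn_le_two hc
    ((compl_ne_univ_iff_nonempty _).2 componentVerts_nonempty)
  refine ⟨v, mem_compl.2 fun hcubic => ?_, hdeg⟩
  have heq : degreeIn G (componentVerts c)ᶜ v = G.degree v :=
    degreeIn_eq_degree fun w hw => mem_compl.2 fun hwc =>
      mem_compl.1 hv (mem_componentVerts_of_adj hwc hcubic hw.symm)
  rw [mem_cubic.1 hcubic] at heq
  omega

theorem degreeIn_add_degreeIn_lt (hG : NonInducedCritical G)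
    (hc : ∀ c : CubicComponent G, 2 ≤ #(componentVerts c)ᶜ) {c d : CubicComponent G} (hcd : c ≠ d)
    {v : V} (hv : v ∈ (cubic G)ᶜ) (hcard : 3 ≤ #(cubic G)ᶜ) :
    degreeIn G (componentVerts c) v + degreeIn G (componentVerts d) v < G.degree v := by
  have hcdisj := disjoint_componentVerts hcd
  have hvnot : v ∉ componentVerts c ∪ componentVerts d := fun h =>
    mem_compl.1 hv ((union_subset componentVerts_subset componentVerts_subset) h)
  have hcompl : 2 ≤ #(insert v (componentVerts c ∪ componentVerts d))ᶜ := by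
    have hsub : (cubic G)ᶜ.erase v ⊆ (insert v (componentVerts c ∪ componentVerts d))ᶜ := by
      rw [compl_insert]
      exact erase_subset_erase v
        (compl_subset_compl.2 (union_subset componentVerts_subset componentVerts_subset))
    have := card_le_card hsub
    rw [card_erase_of_mem hv] at this
    omega
  have hle := hG.card_interedges_self_add_le (insert_nonempty _ _) hcompl
  rw [card_interedges_self_insert hvnot, card_interedges_union_self hcdisj, degreeIn_union hcdisj,
    card_insert_of_notMem hvnot, card_union_of_disjoint hcdisj, sum_insert hvnot,
    sum_union hcdisj, sum_degree_componentVerts, sum_degree_componentVerts] at hle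
  have hctree := hG.card_interedges_componentVerts (hc c)
  have hdtree := hG.card_interedges_componentVerts (hc d)
  omega

theorem card_compl_cubic_le_two [Nontrivial V] (hG : NonInducedCritical G)
    (hc : ∀ c : CubicComponent G, 2 ≤ #(componentVerts c)ᶜ) : #(cubic G)ᶜ ≤ 2 := by
  have := Fintype.ofFinite (CubicComponent G)
  by_contra! hcard
  choose t ht hdeg using fun c : CubicComponent G =>
    hG.exists_degreeIn_compl_componentVerts_le_two c (card_pos.1 (by have := hc c; omega))
  have hcomponents := hG.card_cubicComponent_add_two hc
  obtain ⟨c, -, d, -, hcd, heq⟩ := exists_ne_map_eq_of_card_lt_of_maps_to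
    (s := univ) (t := (cubic G)ᶜ) (f := t) (by rw [card_univ]; omega) fun c _ => ht c
  have hlt := hG.degreeIn_add_degreeIn_lt hc hcd (ht c) hcard
  have hcsum := degreeIn_add_degreeIn_compl (G := G) (componentVerts c) (t c)
  have hdsum := degreeIn_add_degreeIn_compl (G := G) (componentVerts d) (t c)
  have hcdeg := hdeg c
  have hddeg := hdeg d
  have hne := mem_cubic.not.1 (mem_compl.1 (ht c))
  rw [← heq] at hddeg
  have hthree := hG.three_le_degree (t c)
  omega

theorem card_compl_cubic_and_card_cubicComponent [Nontrivial V] [Fintype (CubicComponent G)]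
    (hG : NonInducedCritical G) (hc : ∀ c : CubicComponent G, 2 ≤ #(componentVerts c)ᶜ) :
    #(cubic G)ᶜ = 2 ∧ Fintype.card (CubicComponent G) = 2 := by
  have hle := hG.card_compl_cubic_le_two hc
  have hcomponents := hG.card_cubicComponent_add_two hc
  suffices #(cubic G)ᶜ ≠ 1 by omega
  intro hone
  have hempty : IsEmpty (CubicComponent G) := Fintype.card_eq_zero_iff.1 (by omega)
  have hcubic : cubic G = ∅ := eq_empty_of_forall_notMem fun v hv =>
    hempty.false ((G.induce (cubic G : Set V)).connectedComponentMk ⟨v, hv⟩)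
  have hcard := hG.four_le_card
  rw [hcubic, compl_empty, card_univ] at hone
  omega

end NonInducedCritical

end Cubic

section Wheels

@[simp]
theorem wheelGraph_adj_none_some {m : ℕ} (i : Fin m) : (wheelGraph m).Adj none (some i) :=
  trivial

@[simp]
theorem wheelGraph_adj_some_none {m : ℕ} (i : Fin m) : (wheelGraph m).Adj (some i) none :=
  trivial

@[simp]
theorem wheelGraph_adj_some_some {m : ℕ} {i j : Fin m} :
    (wheelGraph m).Adj (some i) (some j) ↔ (SimpleGraph.cycleGraph m).Adj i j :=
  Iff.rfl

theorem isUniversal_wheelGraph_none {m : ℕ} : (wheelGraph m).IsUniversal none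
  | none, h => absurd rfl h
  | some i, _ => wheelGraph_adj_none_some i

theorem degree_wheelGraph_some {m : ℕ} [(wheelGraph m).LocallyFinite] (i : Fin m) :
    (wheelGraph m).degree (some i) = (SimpleGraph.cycleGraph m).degree i + 1 := by
  have hnbhd : (wheelGraph m).neighborFinset (some i) =
      insertNone ((SimpleGraph.cycleGraph m).neighborFinset i) := by
    ext (_ | j) <;> simp
  rw [← SimpleGraph.card_neighborFinset_eq_degree, hnbhd, card_insertNone,
    SimpleGraph.card_neighborFinset_eq_degree]

theorem degree_wheelGraph_some_eq_three {m : ℕ} (hm : 3 ≤ m) [(wheelGraph m).LocallyFinite]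
    (i : Fin m) : (wheelGraph m).degree (some i) = 3 := by
  obtain ⟨k, rfl⟩ := Nat.exists_eq_add_of_le' hm
  rw [degree_wheelGraph_some, SimpleGraph.cycleGraph_degree_three_le]

theorem ncard_edgeSet_wheelGraph {m : ℕ} (hm : 3 ≤ m) :
    (wheelGraph m).edgeSet.ncard = 2 * m := by
  classical
  have hsum := (wheelGraph m).sum_degrees_eq_twice_card_edges
  rw [Fintype.sum_option,
    ((wheelGraph m).degree_eq_card_sub_one none).2 isUniversal_wheelGraph_none,
    sum_congr rfl fun i _ => degree_wheelGraph_some_eq_three hm i, sum_const, card_univ,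
    Fintype.card_option, Fintype.card_fin, smul_eq_mul] at hsum
  rw [← SimpleGraph.coe_edgeFinset, Set.ncard_coe_finset]
  omega

variable {V : Type*} {G : SimpleGraph V}

theorem exists_embedding_option {α : Type*} {R : Set V} {z : V} (hz : z ∉ R) (e : α ≃ R) :
    ∃ f : Option α ↪ V, f none = z ∧ (∀ a, f (some a) = e a) ∧ Set.range f = insert z R := by
  refine ⟨(e.toEmbedding.trans (.subtype _)).optionElim z ?_, rfl, fun _ => rfl, ?_⟩
  · rintro ⟨a, rfl⟩
    exact hz (e a).2
  · ext v
    rw [Set.mem_range, Option.exists, Set.mem_insert_iff]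
    refine or_congr eq_comm ⟨?_, fun hv => ⟨e.symm ⟨v, hv⟩, by simp⟩⟩
    rintro ⟨a, rfl⟩
    exact (e a).2

theorem isWheel_of_iso_cycleGraph {R : Set V} {z : V} (hz : ∀ v, v ∈ R ↔ v ≠ z)
    (hadj : G.IsUniversal z) {m : ℕ} (hm : 3 ≤ m)
    (e : G.induce R ≃g SimpleGraph.cycleGraph m) : IsWheel G := by
  obtain ⟨f, hfz, hfR, hrange⟩ := exists_embedding_option (fun h => (hz z).1 h rfl) e.symm.toEquiv
  have hf : Function.Bijective f := by
    refine ⟨f.injective, Set.range_eq_univ.1 (hrange.trans (Set.eq_univ_of_forall fun v => ?_))⟩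
    exact or_iff_not_imp_left.2 (hz v).2
  have hspoke (i : Fin m) : G.Adj z (e.symm i) := hadj ((hz _).1 (e.symm i).2).symm
  refine ⟨m, hm, ⟨SimpleGraph.Iso.symm ⟨Equiv.ofBijective f hf, ?_⟩⟩⟩
  rintro (_ | i) (_ | j)
  · simp
  · simp [hfz, hfR, hspoke]
  · simp [hfz, hfR, (hspoke i).symm]
  · simp [hfR, ← e.symm.map_adj_iff]

theorem wheelGraph_three : wheelGraph 3 = ⊤ := by
  ext (_ | i) (_ | j) <;> simp [SimpleGraph.cycleGraph_three_eq_top]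

theorem isWheel_of_isRegularOfDegree_three [Fintype V] [DecidableRel G.Adj]
    (hdeg : G.IsRegularOfDegree 3) (hcard : Fintype.card V = 4) : IsWheel G := by
  have htop : G = ⊤ := by
    ext v w
    exact ⟨fun h => h.ne, fun h => (G.degree_eq_card_sub_one v).1 (by rw [hdeg v, hcard]) h⟩
  refine ⟨3, le_rfl, ?_⟩
  rw [htop, wheelGraph_three]
  exact ⟨SimpleGraph.Iso.completeGraph (Fintype.equivOfCardEq (by simp [hcard]))⟩

end Wheels

section CubicWheels

variable {V : Type*} [Fintype V] {G : SimpleGraph V} [DecidableRel G.Adj]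

namespace NonInducedCritical

theorem isWheel_of_componentVerts_eq_univ (hG : NonInducedCritical G) {c : CubicComponent G}
    (hc : componentVerts c = univ) : IsWheel G := by
  have hdeg : G.IsRegularOfDegree 3 := fun v =>
    degree_eq_three_of_mem_componentVerts (hc ▸ mem_univ v)
  refine isWheel_of_isRegularOfDegree_three hdeg ?_
  have hsum := sum_degree_componentVerts c
  rw [hc, G.sum_degrees_eq_twice_card_edges, card_univ] at hsum
  have hedges := hG.1
  rw [← G.coe_edgeFinset, Set.ncard_coe_finset] at hedges
  omega

variable [DecidableEq V]

theorem isUniversal_of_compl_componentVerts_eq_singleton (hG : NonInducedCritical G)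
    {c : CubicComponent G} {z : V} (hz : (componentVerts c)ᶜ = {z}) : G.IsUniversal z := by
  rw [← G.degree_eq_card_sub_one]
  have hsum := sum_add_sum_compl (componentVerts c) (G.degree ·)
  rw [hz, sum_singleton, sum_degree_componentVerts, G.sum_degrees_eq_twice_card_edges] at hsum
  have hcard := card_add_card_compl (componentVerts c)
  rw [hz, card_singleton] at hcard
  have hedges := hG.1
  rw [← G.coe_edgeFinset, Set.ncard_coe_finset] at hedges
  omega

theorem isWheel_of_compl_componentVerts_eq_singleton (hG : NonInducedCritical G)
    {c : CubicComponent G} {z : V} (hz : (componentVerts c)ᶜ = {z}) : IsWheel G := by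
  have huniv := hG.isUniversal_of_compl_componentVerts_eq_singleton hz
  have hmem (v : V) : v ∈ componentVerts c ↔ v ≠ z := by
    rw [← notMem_compl, hz, mem_singleton]
  have hdeg (v : (componentVerts c : Set V)) :
      (G.induce (componentVerts c : Set V)).degree v = 2 := by
    have hsum := degreeIn_add_degreeIn_compl (G := G) (componentVerts c) v
    have hone : degreeIn G {z} v = 1 := by
      simp [degreeIn, filter_singleton, (huniv ((hmem v).1 v.2).symm).symm]
    rw [degree_eq_three_of_mem_componentVerts v.2, hz, hone] at hsum
    rw [degree_induce_eq_degreeIn]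
    omega
  obtain ⟨v, hv⟩ := componentVerts_nonempty (c := c)
  obtain ⟨m, hm, e, -⟩ :=
    exists_iso_cycleGraph_of_degree_eq_two connected_induce_componentVerts hdeg ⟨v, hv⟩
  exact isWheel_of_iso_cycleGraph hmem huniv (by omega) e

theorem isWheel_of_card_compl_componentVerts_le_one (hG : NonInducedCritical G)
    {c : CubicComponent G} (hc : #(componentVerts c)ᶜ ≤ 1) : IsWheel G := by
  rcases Nat.le_one_iff_eq_zero_or_eq_one.1 hc with hzero | hone
  · exact hG.isWheel_of_componentVerts_eq_univ (by simpa using hzero)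
  · obtain ⟨z, hz⟩ := card_eq_one.1 hone
    exact hG.isWheel_of_compl_componentVerts_eq_singleton hz

end NonInducedCritical

end CubicWheels

section HGraphs

variable {n : ℕ}

theorem not_hGraph_adj_x_y : ¬ (HGraph n).Adj .x .y := by
  rintro ⟨-, h | h⟩ <;> cases h

theorem hGraph_adj_x_v (i : Fin (n - 2)) : (HGraph n).Adj .x (.v i) :=
  ⟨nofun, .inl (.x i)⟩

theorem hGraph_adj_y_v {i : Fin (n - 2)} :
    (HGraph n).Adj .y (.v i) ↔ (i : ℕ) = 0 ∨ (i : ℕ) + 1 = n - 2 := by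
  constructor
  · rintro ⟨-, h | h⟩
    · cases h with
      | y_first _ h => exact .inl h
      | y_last _ h => exact .inr h
    · cases h
  · rintro (h | h)
    · exact ⟨nofun, .inl (.y_first i h)⟩
    · exact ⟨nofun, .inl (.y_last i h)⟩

theorem hGraph_adj_v_v {i j : Fin (n - 2)} :
    (HGraph n).Adj (.v i) (.v j) ↔ (i : ℕ) + 1 = j ∨ (j : ℕ) + 1 = i := by
  constructor
  · rintro ⟨-, h | h⟩
    · cases h with | path _ _ h => exact .inl h
    · cases h with | path _ _ h => exact .inr h
  · have hne (k l : Fin (n - 2)) (h : (k : ℕ) + 1 = l) : HVertex.v k ≠ .v l := by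
      rintro ⟨⟩
      omega
    rintro (h | h)
    · exact ⟨hne i j h, .inl (.path i j h)⟩
    · exact ⟨(hne j i h).symm, .inr (.path j i h)⟩

theorem cycleGraph_adj_iff_of_lt {m : ℕ} {i j : Fin m} (h : i < j) :
    (SimpleGraph.cycleGraph m).Adj i j ↔
      (i : ℕ) + 1 = j ∨ ((i : ℕ) = 0 ∧ (j : ℕ) + 1 = m) := by
  rw [SimpleGraph.cycleGraph_adj', Fin.coe_sub_iff_lt.2 h, Fin.sub_val_of_le h.le]
  omega

theorem cycleGraph_adj_zero_succ {m : ℕ} {i : Fin m} :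
    (SimpleGraph.cycleGraph (m + 1)).Adj 0 i.succ ↔ (i : ℕ) = 0 ∨ (i : ℕ) + 1 = m := by
  rw [cycleGraph_adj_iff_of_lt i.succ_pos]
  simp only [Fin.val_zero, Fin.val_succ, true_and]
  omega

theorem cycleGraph_adj_succ_succ {m : ℕ} {i j : Fin m} :
    (SimpleGraph.cycleGraph (m + 1)).Adj i.succ j.succ ↔
      (i : ℕ) + 1 = j ∨ (j : ℕ) + 1 = i := by
  wlog h : i < j generalizing i j
  · rcases (not_lt.1 h).eq_or_lt with rfl | h
    · simp
    · rw [SimpleGraph.adj_comm, this h, or_comm]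
  rw [cycleGraph_adj_iff_of_lt (Fin.succ_lt_succ_iff.2 h)]
  simp only [Fin.val_succ]
  omega

/-- The bijection behind `hGraphIso`: `x` is the centre and `y, v 0, v 1, …` are the outside
vertices in cyclic order. -/
def hVertexEquiv (m : ℕ) : HVertex (m + 2) ≃ Option (Fin (m + 1)) where
  toFun
    | .x => none
    | .y => some 0
    | .v i => some (Fin.succ i)
  invFun o := o.elim .x fun i => Fin.cases .y (fun i => .v (n := m + 2) i) i
  left_inv := by rintro (_ | _ | i) <;> rfl
  right_inv := by
    rintro (_ | i)
    · rfl
    · cases i using Fin.cases <;> rfl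

/-- `H_n` is a wheel with one spoke deleted: the centre of the wheel and the outside end of that
spoke are the connectors. -/
def hGraphIso (m : ℕ) :
    HGraph (m + 2) ≃g (wheelGraph (m + 1)).deleteEdges {s(none, some 0)} where
  toEquiv := hVertexEquiv m
  map_rel_iff' := by
    have hyx := (HGraph (m + 2)).adj_comm .y .x
    have hvx (i : Fin m) := (HGraph (m + 2)).adj_comm (.v i) .x
    have hvy (i : Fin m) := (HGraph (m + 2)).adj_comm (.v i) .y
    have hcycle (i : Fin m) := (SimpleGraph.cycleGraph (m + 1)).adj_comm i.succ 0
    rintro (_ | _ | i) (_ | _ | j) <;>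
      simp [hVertexEquiv, hyx, hvx, hvy, hcycle, not_hGraph_adj_x_y, hGraph_adj_x_v,
        hGraph_adj_y_v, hGraph_adj_v_v, cycleGraph_adj_zero_succ, cycleGraph_adj_succ_succ,
        Fin.succ_ne_zero]

theorem card_hVertex (m : ℕ) : Nat.card (HVertex (m + 2)) = m + 2 := by
  simp [Nat.card_congr (hVertexEquiv m)]

theorem ncard_edgeSet_hGraph_add_one {m : ℕ} (hm : 2 ≤ m) :
    (HGraph (m + 2)).edgeSet.ncard + 1 = 2 * (m + 1) := by
  have hcongr := Nat.card_congr (hGraphIso m).mapEdgeSet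
  rw [Nat.card_coe_set_eq, Nat.card_coe_set_eq, SimpleGraph.edgeSet_deleteEdges] at hcongr
  rw [hcongr, Set.ncard_sdiff_singleton_add_one, ncard_edgeSet_wheelGraph (by omega)]
  exact wheelGraph_adj_none_some (0 : Fin (m + 1))

theorem degree_hGraph_v_le_three {m : ℕ} (hm : 2 ≤ m) [(HGraph (m + 2)).LocallyFinite]
    (i : Fin m) : (HGraph (m + 2)).degree (.v i) ≤ 3 := by
  classical
  rw [← (hGraphIso m).degree_eq, ← degree_wheelGraph_some_eq_three (m := m + 1) (by omega) i.succ]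
  exact SimpleGraph.degree_le_of_le (SimpleGraph.deleteEdges_le _)

theorem degree_hGraph_y_le_two {m : ℕ} [(HGraph (m + 2)).LocallyFinite] (hm : 0 < m) :
    (HGraph (m + 2)).degree .y ≤ 2 := by
  classical
  have hsub : (HGraph (m + 2)).neighborFinset .y ⊆
      {.v (⟨0, hm⟩ : Fin m), .v (⟨m - 1, by omega⟩ : Fin m)} := by
    rintro (_ | _ | i) hi <;> rw [SimpleGraph.mem_neighborFinset] at hi
    · exact absurd hi.symm not_hGraph_adj_x_y
    · exact absurd hi (SimpleGraph.irrefl _)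
    · rw [mem_insert, mem_singleton]
      refine (hGraph_adj_y_v.1 hi).imp (fun h => ?_) fun h => ?_
      · exact congrArg HVertex.v (Fin.ext h)
      · exact congrArg HVertex.v (Fin.ext (Nat.eq_sub_of_add_eq h))
  rw [← SimpleGraph.card_neighborFinset_eq_degree]
  exact (card_le_card hsub).trans card_le_two

theorem exists_hGraph_adj (hn : 2 < n) (a : HVertex n) : ∃ b, (HGraph n).Adj a b := by
  rcases a with _ | _ | k
  · exact ⟨.v ⟨0, by omega⟩, hGraph_adj_x_v _⟩
  · exact ⟨.v ⟨0, by omega⟩, hGraph_adj_y_v.2 (.inl rfl)⟩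
  · exact ⟨.x, (hGraph_adj_x_v k).symm⟩

theorem exists_eq_v_of_hGraph_adj {a b : HVertex n} (h : (HGraph n).Adj a b) :
    (∃ k, a = .v k) ∨ ∃ k, b = .v k := by
  rcases a with _ | _ | k
  · rcases b with _ | _ | k
    · exact absurd h (SimpleGraph.irrefl _)
    · exact absurd h not_hGraph_adj_x_y
    · exact .inr ⟨k, rfl⟩
  · rcases b with _ | _ | k
    · exact absurd h.symm not_hGraph_adj_x_y
    · exact absurd h (SimpleGraph.irrefl _)
    · exact .inr ⟨k, rfl⟩
  · exact .inl ⟨k, rfl⟩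

theorem ncard_edgeSet_map_hGraph {V : Type*} (hn : 4 ≤ n) (f : HVertex n ↪ V) :
    ((HGraph n).map f).edgeSet.ncard + 3 = 2 * n := by
  obtain ⟨m, rfl⟩ := Nat.exists_eq_add_of_le' (show 2 ≤ n by omega)
  rw [SimpleGraph.edgeSet_map, Set.ncard_image_of_injective _ f.sym2Map.injective]
  have := ncard_edgeSet_hGraph_add_one (show 2 ≤ m by omega)
  omega

theorem ncard_range_hVertex {V : Type*} (hn : 2 ≤ n) (f : HVertex n ↪ V) :
    (Set.range f).ncard = n := by
  obtain ⟨m, rfl⟩ := Nat.exists_eq_add_of_le' hn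
  rw [← Set.image_univ, Set.ncard_image_of_injective _ f.injective, Set.ncard_univ, card_hVertex]

end HGraphs

section HGraphEmbedding

variable {V : Type*} {G : SimpleGraph V}

theorem exists_hGraph_embedding_of_iso_cycleGraph {R : Set V} {x y : V} (hx : x ∉ R) (hy : y ∈ R)
    {m : ℕ} (e : G.induce R ≃g SimpleGraph.cycleGraph (m + 1)) (hey : e ⟨y, hy⟩ = 0)
    (hadj : ∀ v ∈ R, G.Adj x v ↔ v ≠ y) :
    ∃ f : HGraph (m + 2) ↪g G, f .x = x ∧ f .y = y ∧ Set.range f = insert x R := by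
  obtain ⟨g, hgx, hgR, hrange⟩ := exists_embedding_option hx e.symm.toEquiv
  have hspoke (i : Fin (m + 1)) : G.Adj x (e.symm i) ↔ i ≠ 0 := by
    rw [hadj _ (e.symm i).2, ← hey, Ne, Ne, ← Subtype.ext_iff (a2 := ⟨y, hy⟩), e.symm_apply_eq]
  let g' : (wheelGraph (m + 1)).deleteEdges {s(none, some 0)} ↪g G := ⟨g, by
    rintro (_ | i) (_ | j)
    · simp
    · simp [hgx, hgR, hspoke]
    · simp [hgx, hgR, hspoke, G.adj_comm _ x]
    · simp [hgR, ← e.symm.map_adj_iff]⟩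
  refine ⟨g'.comp (hGraphIso m).toEmbedding, hgx, ?_, ?_⟩
  · exact (hgR 0).trans (congrArg Subtype.val (e.symm_apply_eq.2 hey.symm))
  · exact ((hGraphIso m).surjective.range_comp g).trans hrange

end HGraphEmbedding

section HGraphPieces

variable {V : Type*} [DecidableEq V] {G : SimpleGraph V} [DecidableRel G.Adj]

theorem degreeIn_insert_eq_two {Q : Finset V} {y : V} (hy : y ∉ Q)
    (hQ : #(G.interedges Q Q) + 2 ≤ 2 * #Q) (hdeg : ∀ v ∈ Q, 2 ≤ degreeIn G (insert y Q) v)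
    (hydeg : degreeIn G Q y ≤ 2) : ∀ v ∈ insert y Q, degreeIn G (insert y Q) v = 2 := by
  have hinsert := card_interedges_self_insert (G := G) hy
  have hself : degreeIn G (insert y Q) y = degreeIn G Q y := by
    rw [degreeIn_insert hy, if_neg G.irrefl, add_zero]
  rw [card_interedges_eq_sum (insert y Q), sum_insert hy, hself] at hinsert
  have hlower := sum_le_sum hdeg
  rw [sum_const, smul_eq_mul] at hlower
  have hsum : ∑ v ∈ Q, 2 = ∑ v ∈ Q, degreeIn G (insert y Q) v := by
    rw [sum_const, smul_eq_mul]
    omega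
  have hQdeg := (sum_eq_sum_iff_of_le hdeg).1 hsum
  rw [forall_mem_insert]
  exact ⟨by omega, fun v hv => (hQdeg v hv).symm⟩

theorem exists_hGraph_embedding {Q : Finset V} {x y : V} (hxQ : x ∉ Q) (hyQ : y ∉ Q) (hxy : x ≠ y)
    (hnadj : ¬ G.Adj x y) (hconn : (G.induce (Q : Set V)).Connected)
    (hQ : #(G.interedges Q Q) + 2 ≤ 2 * #Q)
    (hdeg : ∀ v ∈ Q, 3 ≤ degreeIn G (insert x (insert y Q)) v) (hydeg : degreeIn G Q y ≤ 2) :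
    ∃ i, 4 ≤ i ∧ ∃ f : HGraph i ↪g G,
      f .x = x ∧ f .y = y ∧ Set.range f = insert x (insert y (Q : Set V)) := by
  have hxR : x ∉ insert y Q := by simp [hxQ, hxy]
  simp only [degreeIn_insert hxR] at hdeg
  have htwo := degreeIn_insert_eq_two hyQ hQ
    (fun v hv => by have := hdeg v hv; split_ifs at this <;> omega) hydeg
  have hcycle : (G.induce (insert y Q : Finset V)).Connected := by
    obtain ⟨w, hw, h⟩ : ∃ w ∈ Q, G.Adj y w := degreeIn_pos.1 (by
      have := htwo y (mem_insert_self y Q)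
      rw [degreeIn_insert hyQ, if_neg G.irrefl] at this
      omega)
    rw [coe_insert, Set.insert_eq]
    exact SimpleGraph.connected_induce_union (SimpleGraph.Preconnected.of_subsingleton)
      hconn.preconnected rfl hw h
  obtain ⟨m, hm, e, he⟩ := exists_iso_cycleGraph_of_degree_eq_two hcycle
    (fun v => (degree_induce_eq_degreeIn _ v).trans (htwo v v.2)) ⟨y, mem_insert_self y Q⟩
  have hadj (v : V) (hv : v ∈ insert y Q) : G.Adj x v ↔ v ≠ y := by
    refine ⟨fun h hvy => hnadj (hvy ▸ h), fun hvy => ?_⟩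
    have := hdeg v (mem_of_mem_insert_of_ne hv hvy)
    rw [htwo v hv] at this
    by_contra h
    rw [if_neg fun h' => h h'.symm] at this
    omega
  obtain ⟨f, hfx, hfy, hrange⟩ := exists_hGraph_embedding_of_iso_cycleGraph hxR
    (mem_insert_self y Q) e he hadj
  exact ⟨m + 2, by omega, f, hfx, hfy, by rw [hrange, coe_insert]⟩

end HGraphPieces

section Gluing

variable {V : Type*} {G : SimpleGraph V}

theorem isHGluing_of_embeddings {i j : ℕ} (hi : 4 ≤ i) (hj : 4 ≤ j) (f : HGraph i ↪g G)
    (g : HGraph j ↪g G) (hconn : (f .x = g .x ∧ f .y = g .y) ∨ (f .x = g .y ∧ f .y = g .x))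
    (hinter : Set.range f ∩ Set.range g = {f .x, f .y})
    (hunion : Set.range f ∪ Set.range g = Set.univ)
    (hadj : ∀ v w, G.Adj v w →
      (v ∈ Set.range f ∧ w ∈ Set.range f) ∨ (v ∈ Set.range g ∧ w ∈ Set.range g)) :
    IsHGluing G := by
  refine ⟨i, j, hi, hj, f.toEmbedding, g.toEmbedding, hconn, hinter, hunion, le_antisymm ?_ ?_⟩
  · intro v w h
    rcases hadj v w h with ⟨⟨a, rfl⟩, b, rfl⟩ | ⟨⟨a, rfl⟩, b, rfl⟩
    · exact .inl (SimpleGraph.map_adj_apply.2 (f.map_adj_iff.1 h))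
    · exact .inr (SimpleGraph.map_adj_apply.2 (g.map_adj_iff.1 h))
  · refine sup_le ?_ ?_ <;> rw [SimpleGraph.map_le_iff_le_comap] <;> intro a b h
    · exact f.map_adj_iff.2 h
    · exact g.map_adj_iff.2 h

end Gluing

namespace NonInducedCritical

variable {V : Type*} [Fintype V] [DecidableEq V] {G : SimpleGraph V} [DecidableRel G.Adj]

theorem exists_hGraph_embedding_componentVerts (hG : NonInducedCritical G)
    (hc : ∀ c : CubicComponent G, 2 ≤ #(componentVerts c)ᶜ) {c d : CubicComponent G} (hcd : c ≠ d)
    {s t : V} (hst : s ≠ t) (hcompl : (cubic G)ᶜ = {s, t}) :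
    ∃ i, 4 ≤ i ∧ ∃ f : HGraph i ↪g G, ((f .x = s ∧ f .y = t) ∨ (f .x = t ∧ f .y = s)) ∧
      Set.range f = ((cubic G)ᶜ ∪ componentVerts d : Finset V) := by
  obtain ⟨y, hy, hdeg⟩ := hG.exists_degreeIn_compl_componentVerts_le_two c
    (card_pos.1 (by have := hc c; omega))
  wlog hyt : y = t generalizing s t
  · have hys : y = s := by
      rw [hcompl, mem_insert, mem_singleton] at hy
      exact hy.resolve_right hyt
    obtain ⟨i, hi, f, hf, hrange⟩ := this hst.symm (by rw [hcompl, pair_comm]) hys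
    exact ⟨i, hi, f, hf.symm, hrange⟩
  subst hyt
  have hy : y ∉ cubic G := mem_compl.1 hy
  have hs : s ∉ cubic G := mem_compl.1 (hcompl ▸ mem_insert_self s {y})
  have hnadj : ¬ G.Adj s y := fun h =>
    (hG.degree_eq_three_of_adj h).elim (hs ∘ mem_cubic.2) (hy ∘ mem_cubic.2)
  have hpiece : insert s (insert y (componentVerts d)) = (cubic G)ᶜ ∪ componentVerts d := by
    rw [hcompl, insert_union, singleton_union]
  have hdeg_three (v : V) (hv : v ∈ componentVerts d) :
      3 ≤ degreeIn G (insert s (insert y (componentVerts d))) v := by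
    rw [hpiece, degreeIn_eq_degree fun w => mem_compl_union_componentVerts_of_adj hv,
      degree_eq_three_of_mem_componentVerts hv]
  have hsub : componentVerts d ⊆ (componentVerts c)ᶜ := fun v hv =>
    mem_compl.2 fun hvc => disjoint_left.1 (disjoint_componentVerts hcd) hvc hv
  obtain ⟨i, hi, f, hfx, hfy, hrange⟩ := exists_hGraph_embedding (Q := componentVerts d)
    (hs ∘ @componentVerts_subset _ _ _ _ _) (hy ∘ @componentVerts_subset _ _ _ _ _) hst hnadj
    connected_induce_componentVerts (hG.card_interedges_componentVerts (hc d)).le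
    hdeg_three ((degreeIn_mono hsub y).trans hdeg)
  exact ⟨i, hi, f, .inl ⟨hfx, hfy⟩, by rw [hrange, ← hpiece, coe_insert, coe_insert]⟩

theorem isHGluing_of_two_le_card_compl_componentVerts [Nontrivial V] (hG : NonInducedCritical G)
    (hc : ∀ c : CubicComponent G, 2 ≤ #(componentVerts c)ᶜ) : IsHGluing G := by
  classical
  have := Fintype.ofFinite (CubicComponent G)
  obtain ⟨hcompl, hcomponents⟩ := hG.card_compl_cubic_and_card_cubicComponent hc
  obtain ⟨s, t, hst, hcompl⟩ := card_eq_two.1 hcompl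
  obtain ⟨c, d, hcd, hcomponents⟩ := card_eq_two.1 (card_univ.trans hcomponents)
  obtain ⟨i, hi, f, hf, hfrange⟩ :=
    hG.exists_hGraph_embedding_componentVerts hc hcd.symm hst hcompl
  obtain ⟨j, hj, g, hg, hgrange⟩ := hG.exists_hGraph_embedding_componentVerts hc hcd hst hcompl
  have hcover {v : V} (hv : v ∈ cubic G) : v ∈ componentVerts c ∨ v ∈ componentVerts d := by
    obtain ⟨e, he⟩ := exists_mem_componentVerts hv
    rcases mem_insert.1 (hcomponents ▸ mem_univ e) with rfl | hed
    · exact .inl he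
    · exact .inr (mem_singleton.1 hed ▸ he)
  have hedge {e : CubicComponent G} {v w : V} (hv : v ∈ componentVerts e) (h : G.Adj v w) :
      v ∈ (cubic G)ᶜ ∪ componentVerts e ∧ w ∈ (cubic G)ᶜ ∪ componentVerts e :=
    ⟨mem_union_right _ hv, mem_compl_union_componentVerts_of_adj hv h⟩
  refine isHGluing_of_embeddings hi hj f g (by grind) ?_ ?_ fun v w h => ?_
  · rw [hfrange, hgrange, ← coe_inter, ← union_inter_distrib_left,
      disjoint_iff_inter_eq_empty.1 (disjoint_componentVerts hcd), union_empty, hcompl, coe_pair]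
    rcases hf with ⟨hx, hy⟩ | ⟨hx, hy⟩
    · rw [hx, hy]
    · rw [hx, hy, Set.pair_comm]
  · refine Set.eq_univ_of_forall fun v => ?_
    rw [hfrange, hgrange]
    by_cases hv : v ∈ cubic G
    · exact (hcover hv).imp (mem_union_right _) (mem_union_right _)
    · exact .inl (mem_union_left _ (mem_compl.2 hv))
  · rw [hfrange, hgrange]
    rcases hG.degree_eq_three_of_adj h with hv | hw
    · exact (hcover (mem_cubic.2 hv)).imp (hedge · h) (hedge · h)
    · exact (hcover (mem_cubic.2 hw)).imp (fun hw => (hedge hw h.symm).symm)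
        fun hw => (hedge hw h.symm).symm

end NonInducedCritical

section WheelIsCritical

variable {V : Type*} [Finite V] {G : SimpleGraph V}

theorem MinDegreeAtLeast.eq_top_of_iso_wheelGraph {m : ℕ} (hm : 3 ≤ m) (e : G ≃g wheelGraph m)
    {H : G.Subgraph} (hH : MinDegreeAtLeast H 3) : H = ⊤ := by
  classical
  have := Fintype.ofFinite V
  let φ : SimpleGraph.cycleGraph m →g G := e.symm.toHom.comp ⟨some, id⟩
  have hdeg (i : Fin m) : G.degree (φ i) ≤ 3 :=
    ((e.symm.degree_eq _).trans (degree_wheelGraph_some_eq_three hm i)).le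
  have hrim {v : V} (hv : v ≠ e.symm none) : ∃ i, φ i = v := by
    obtain ⟨i, hi⟩ := Option.ne_none_iff_exists.1 (mt e.eq_symm_apply.2 hv)
    exact ⟨i, e.symm_apply_eq.2 hi⟩
  obtain ⟨v, hv⟩ := hH.1
  obtain ⟨w, hvw, hw⟩ := hH.exists_adj_notMem hv (A := {e.symm none}) (by norm_num)
  obtain ⟨i₀, rfl⟩ := hrim (mt mem_singleton.2 hw)
  have hspoke (i : Fin m) {v : V} (hv : G.Adj (φ i) v) : H.Adj (φ i) v :=
    hH.adj_of_hom (SimpleGraph.cycleGraph_preconnected) φ hdeg hvw.snd_mem i hv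
  refine eq_top_of_forall_adj (fun v => ?_) fun v w h => ?_
  · by_cases hv : v = e.symm none
    · exact ⟨φ i₀, hv ▸ e.symm.map_adj_iff.2 (wheelGraph_adj_none_some i₀)⟩
    · obtain ⟨i, rfl⟩ := hrim hv
      exact ⟨e.symm none, e.symm.map_adj_iff.2 (wheelGraph_adj_some_none i)⟩
  · by_cases hv : v = e.symm none
    · obtain ⟨i, rfl⟩ := hrim (hv ▸ h.ne')
      exact (hspoke i h.symm).symm
    · obtain ⟨i, rfl⟩ := hrim hv
      exact hspoke i h

end WheelIsCritical

theorem IsWheel.nonInducedCritical {V : Type*} [Fintype V] {G : SimpleGraph V} (hG : IsWheel G) :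
    NonInducedCritical G := by
  obtain ⟨m, hm, ⟨e⟩⟩ := hG
  refine nonInducedCritical_iff.2 ⟨?_, fun H hH => hH.eq_top_of_iso_wheelGraph hm e⟩
  have hedges : G.edgeSet.ncard = 2 * m :=
    (Nat.card_congr e.mapEdgeSet).trans (ncard_edgeSet_wheelGraph hm)
  rw [hedges, Fintype.card_congr e.toEquiv, Fintype.card_option, Fintype.card_fin]
  ring

section GluingIsCritical

variable {V : Type*} {G : SimpleGraph V}

/-- `G` is the union of the copies of `H_i` and `H_j` given by `f` and `g`, which share exactly
their connectors; the relation behind `IsHGluing`, with the two copies named. -/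
structure IsHGluingOf (G : SimpleGraph V) {i j : ℕ} (f : HVertex i ↪ V) (g : HVertex j ↪ V) :
    Prop where
  connectors : (f .x = g .x ∧ f .y = g .y) ∨ (f .x = g .y ∧ f .y = g .x)
  inter : Set.range f ∩ Set.range g = {f .x, f .y}
  union : Set.range f ∪ Set.range g = Set.univ
  eq : G = (HGraph i).map f ⊔ (HGraph j).map g

namespace IsHGluingOf

variable {i j : ℕ} {f : HVertex i ↪ V} {g : HVertex j ↪ V}

theorem symm (h : IsHGluingOf G f g) : IsHGluingOf G g f where
  connectors := h.connectors.imp (.imp Eq.symm Eq.symm) fun h => ⟨h.2.symm, h.1.symm⟩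
  inter := by
    rw [Set.inter_comm, h.inter]
    rcases h.connectors with ⟨hx, hy⟩ | ⟨hx, hy⟩
    · rw [hx, hy]
    · rw [hx, hy, Set.pair_comm]
  union := by rw [Set.union_comm, h.union]
  eq := by rw [sup_comm, h.eq]

theorem adj_iff (h : IsHGluingOf G f g) {v w : V} : G.Adj v w ↔
    (∃ a b, (HGraph i).Adj a b ∧ f a = v ∧ f b = w) ∨
      ∃ a b, (HGraph j).Adj a b ∧ g a = v ∧ g b = w := by
  rw [h.eq, SimpleGraph.sup_adj, SimpleGraph.map_adj, SimpleGraph.map_adj]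

theorem adj (h : IsHGluingOf G f g) {a b : HVertex i} (hab : (HGraph i).Adj a b) :
    G.Adj (f a) (f b) :=
  h.adj_iff.2 (.inl ⟨a, b, hab, rfl, rfl⟩)

theorem mem_range_or (h : IsHGluingOf G f g) (v : V) : v ∈ Set.range f ∨ v ∈ Set.range g :=
  h.union.ge (Set.mem_univ v)

theorem eq_x_or_eq_y (h : IsHGluingOf G f g) {a : HVertex i} (ha : f a ∈ Set.range g) :
    a = .x ∨ a = .y := by
  have hmem : f a ∈ Set.range f ∩ Set.range g := ⟨⟨a, rfl⟩, ha⟩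
  rwa [h.inter, Set.mem_insert_iff, Set.mem_singleton_iff, f.injective.eq_iff,
    f.injective.eq_iff] at hmem

theorem exists_adj_of_adj_v (h : IsHGluingOf G f g) {k : Fin (i - 2)} {w : V}
    (hw : G.Adj (f (.v k)) w) : ∃ b, (HGraph i).Adj (.v k) b ∧ f b = w := by
  rcases h.adj_iff.1 hw with ⟨a, b, hab, ha, hb⟩ | ⟨a, -, -, ha, -⟩
  · exact ⟨b, f.injective ha ▸ hab, hb⟩
  · rcases h.eq_x_or_eq_y ⟨a, ha⟩ with h | h <;> cases h

theorem degree_v_le_three [G.LocallyFinite] (h : IsHGluingOf G f g) (hi : 4 ≤ i)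
    (k : Fin (i - 2)) : G.degree (f (.v k)) ≤ 3 := by
  classical
  obtain ⟨m, rfl⟩ := Nat.exists_eq_add_of_le' (show 2 ≤ i by omega)
  have := Fintype.ofEquiv _ (hVertexEquiv m).symm
  have hsub : G.neighborFinset (f (.v k)) ⊆ ((HGraph (m + 2)).neighborFinset (.v k)).map f := by
    intro w hw
    obtain ⟨b, hb, rfl⟩ := h.exists_adj_of_adj_v ((G.mem_neighborFinset _ _).1 hw)
    exact mem_map_of_mem f ((SimpleGraph.mem_neighborFinset _ _ _).2 hb)
  have hle := card_le_card hsub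
  rw [card_map, SimpleGraph.card_neighborFinset_eq_degree,
    SimpleGraph.card_neighborFinset_eq_degree] at hle
  exact hle.trans (degree_hGraph_v_le_three (m := m) (by omega) k)

variable {H : G.Subgraph}

theorem subgraph_adj_v [Finite V] (h : IsHGluingOf G f g) (hi : 4 ≤ i)
    (hH : MinDegreeAtLeast H 3) {k : Fin (i - 2)} (hk : f (.v k) ∈ H.verts) (l : Fin (i - 2))
    {w : V} (hw : G.Adj (f (.v l)) w) : H.Adj (f (.v l)) w := by
  classical
  have := Fintype.ofFinite V
  let φ : SimpleGraph.pathGraph (i - 2) →g G :=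
    ⟨fun k => f (.v k), fun hkl => h.adj (hGraph_adj_v_v.2 (SimpleGraph.pathGraph_adj.1 hkl))⟩
  exact hH.adj_of_hom (SimpleGraph.pathGraph_preconnected _) φ (h.degree_v_le_three hi) hk l hw

theorem subgraph_adj [Finite V] (h : IsHGluingOf G f g) (hi : 4 ≤ i)
    (hH : MinDegreeAtLeast H 3) {k : Fin (i - 2)} (hk : f (.v k) ∈ H.verts) {a b : HVertex i}
    (hab : (HGraph i).Adj a b) : H.Adj (f a) (f b) := by
  rcases exists_eq_v_of_hGraph_adj hab with ⟨l, rfl⟩ | ⟨l, rfl⟩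
  · exact h.subgraph_adj_v hi hH hk l (h.adj hab)
  · exact (h.subgraph_adj_v hi hH hk l (h.adj hab.symm)).symm

theorem exists_v_mem_of_adj (h : IsHGluingOf G f g) {v w : V} (hvw : H.Adj v w) :
    (∃ k, f (.v k) ∈ H.verts) ∨ ∃ k, g (.v k) ∈ H.verts := by
  rcases h.adj_iff.1 hvw.adj_sub with ⟨a, b, hab, rfl, rfl⟩ | ⟨a, b, hab, rfl, rfl⟩
  · rcases exists_eq_v_of_hGraph_adj hab with ⟨k, rfl⟩ | ⟨k, rfl⟩
    · exact .inl ⟨k, hvw.fst_mem⟩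
    · exact .inl ⟨k, hvw.snd_mem⟩
  · rcases exists_eq_v_of_hGraph_adj hab with ⟨k, rfl⟩ | ⟨k, rfl⟩
    · exact .inr ⟨k, hvw.fst_mem⟩
    · exact .inr ⟨k, hvw.snd_mem⟩

/-- The connector `y` has degree `2` in its own copy, so it passes on to the other one. -/
theorem exists_other_v_mem [Finite V] (h : IsHGluingOf G f g) (hi : 4 ≤ i)
    (hH : MinDegreeAtLeast H 3) {k : Fin (i - 2)} (hk : f (.v k) ∈ H.verts) :
    ∃ l, g (.v l) ∈ H.verts := by
  classical
  have hy : f .y ∈ H.verts := by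
    obtain ⟨b, hyb⟩ := exists_hGraph_adj (by omega) (.y : HVertex i)
    exact (h.subgraph_adj hi hH hk hyb).fst_mem
  obtain ⟨m, rfl⟩ := Nat.exists_eq_add_of_le' (show 2 ≤ i by omega)
  have := Fintype.ofEquiv _ (hVertexEquiv m).symm
  have hcard : #(((HGraph (m + 2)).neighborFinset .y).map f) < 3 := by
    rw [card_map, SimpleGraph.card_neighborFinset_eq_degree]
    exact Nat.lt_succ_of_le (degree_hGraph_y_le_two (by omega))
  obtain ⟨w, hw, hwy⟩ := hH.exists_adj_notMem hy hcard
  rcases h.adj_iff.1 hw.adj_sub with ⟨a, b, hab, ha, rfl⟩ | ⟨a, b, hab, ha, rfl⟩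
  · refine absurd (mem_map_of_mem f ?_) hwy
    exact (SimpleGraph.mem_neighborFinset _ _ _).2 (f.injective ha ▸ hab)
  · rcases exists_eq_v_of_hGraph_adj hab with ⟨l, rfl⟩ | ⟨l, rfl⟩
    · rcases h.symm.eq_x_or_eq_y ⟨.y, ha.symm⟩ with h | h <;> cases h
    · exact ⟨l, hw.snd_mem⟩

theorem eq_top_of_v_mem [Finite V] (h : IsHGluingOf G f g) (hi : 4 ≤ i) (hj : 4 ≤ j)
    (hH : MinDegreeAtLeast H 3) {k : Fin (i - 2)} (hk : f (.v k) ∈ H.verts) : H = ⊤ := by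
  obtain ⟨l, hl⟩ := h.exists_other_v_mem hi hH hk
  refine eq_top_of_forall_adj (fun v => ?_) fun v w hvw => ?_
  · rcases h.mem_range_or v with ⟨a, rfl⟩ | ⟨a, rfl⟩
    · obtain ⟨b, hab⟩ := exists_hGraph_adj (by omega) a
      exact ⟨f b, h.adj hab⟩
    · obtain ⟨b, hab⟩ := exists_hGraph_adj (by omega) a
      exact ⟨g b, h.symm.adj hab⟩
  · rcases h.adj_iff.1 hvw with ⟨a, b, hab, rfl, rfl⟩ | ⟨a, b, hab, rfl, rfl⟩
    · exact h.subgraph_adj hi hH hk hab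
    · exact h.symm.subgraph_adj hj hH hl hab

theorem eq_top [Finite V] (h : IsHGluingOf G f g) (hi : 4 ≤ i) (hj : 4 ≤ j)
    (hH : MinDegreeAtLeast H 3) : H = ⊤ := by
  obtain ⟨v, hv⟩ := hH.1
  obtain ⟨w, hw, -⟩ := hH.exists_adj_notMem hv (A := ∅) three_pos
  rcases h.exists_v_mem_of_adj hw with ⟨k, hk⟩ | ⟨k, hk⟩
  · exact h.eq_top_of_v_mem hi hj hH hk
  · exact h.symm.eq_top_of_v_mem hj hi hH hk

theorem card_add_two [Finite V] (h : IsHGluingOf G f g) (hi : 2 ≤ i) (hj : 2 ≤ j) :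
    Nat.card V + 2 = i + j := by
  have hsum := Set.ncard_union_add_ncard_inter (Set.range f) (Set.range g)
  rwa [h.union, h.inter, ncard_range_hVertex hi, ncard_range_hVertex hj, Set.ncard_univ,
    Set.ncard_pair (f.injective.ne (by simp))] at hsum

theorem disjoint_edgeSet (h : IsHGluingOf G f g) :
    Disjoint ((HGraph i).map f).edgeSet ((HGraph j).map g).edgeSet := by
  rw [SimpleGraph.disjoint_edgeSet, disjoint_iff_inf_le]
  rintro v w ⟨⟨-, a, b, hab, rfl, rfl⟩, ⟨-, a', b', -, ha, hb⟩⟩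
  rcases exists_eq_v_of_hGraph_adj hab with ⟨k, rfl⟩ | ⟨k, rfl⟩
  · rcases h.eq_x_or_eq_y ⟨a', ha⟩ with h | h <;> cases h
  · rcases h.eq_x_or_eq_y ⟨b', hb⟩ with h | h <;> cases h

theorem ncard_edgeSet_add_six [Finite V] (h : IsHGluingOf G f g) (hi : 4 ≤ i) (hj : 4 ≤ j) :
    G.edgeSet.ncard + 6 = 2 * (i + j) := by
  have hf := ncard_edgeSet_map_hGraph hi f
  have hg := ncard_edgeSet_map_hGraph hj g
  rw [h.eq, SimpleGraph.edgeSet_sup, Set.ncard_union_eq h.disjoint_edgeSet]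
  omega

end IsHGluingOf

end GluingIsCritical

theorem IsHGluing.nonInducedCritical {V : Type*} [Fintype V] {G : SimpleGraph V}
    (hG : IsHGluing G) : NonInducedCritical G := by
  obtain ⟨i, j, hi, hj, f, g, hconn, hinter, hunion, heq⟩ := hG
  have h : IsHGluingOf G f g := ⟨hconn, hinter, hunion, heq⟩
  refine nonInducedCritical_iff.2 ⟨?_, fun H hH => h.eq_top hi hj hH⟩
  have hcard := h.card_add_two (by omega) (by omega)
  rw [Nat.card_eq_fintype_card] at hcard
  have hedges := h.ncard_edgeSet_add_six hi hj
  omega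

theorem mainTheorem3 {V : Type*} [Fintype V] (hV : 2 ≤ Fintype.card V) (G : SimpleGraph V) :
    NonInducedCritical G ↔ IsWheel G ∨ IsHGluing G := by
  classical
  have : Nontrivial V := Fintype.one_lt_card_iff_nontrivial.1 hV
  refine ⟨fun hG => ?_, fun h => h.elim IsWheel.nonInducedCritical IsHGluing.nonInducedCritical⟩
  by_cases hc : ∀ c : CubicComponent G, 2 ≤ #(componentVerts c)ᶜ
  · exact .inr (hG.isHGluing_of_two_le_card_compl_componentVerts hc)
  · push Not at hc
    obtain ⟨c, hc⟩ := hc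
    exact .inl (hG.isWheel_of_card_compl_componentVerts_le_one (Nat.le_of_lt_succ hc))
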